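/- A qubit observable with outcome set $X$ (finite) is a family $(\mathsf A(x))_{x\in X}$ of positive semidefinite $2\times 2$ complex matrices with $\sum_x \mathsf A(x)=\mathbb 1$. Two observables $\mathsf A,\mathsf B$ with outcome sets $X,Y$ are compatible if there is an observable $\mathsf G$ with outcome set $X\times Y$ such that $\mathsf A(x)=\sum_y \mathsf G(x,y)$ and $\mathsf B(y)=\sum_x \mathsf G(x,y)$ for all $x,y$; otherwise they are incompatible. For a set $\mathcal S_0$ of density matrices (states), $\mathsf A,\mathsf B$ are $\mathcal S_0$-compatible if there are compatible observables $\mathsf A',\mathsf B'$ with the same outcome sets such that $\mathrm{tr}[\varrho \mathsf A'(x)]=\mathrm{tr}[\varrho \mathsf A(x)]$ and $\mathrm{tr}[\varrho \mathsf B'(y)]=\mathrm{tr}[\varrho \mathsf B(y)]$ for all $\varrho\in\mathcal S_0$, $x\in X$, $y\in Y$; otherwise they are $\mathcal S_0$-incompatible. The incompatibility dimension $\chi_{incomp}(\mathsf A,\mathsf B)$ of incompatible observables is the minimum of $\dim \mathrm{aff}\,\mathcal S_0+1$ over all sets $\mathcal S_0$ of states for which $\mathsf A,\mathsf B$ are $\mathcal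 S_0$-incompatible, where $\mathrm{aff}\,\mathcal S_0$ is the real affine hull. For $0\le t\le 1$ let $$\mathsf A^{t\mathbf x}(\pm)=\tfrac12(\mathbb 1\pm t\sigma_1),\qquad \mathsf A^{t\mathbf y}(\pm)=\tfrac12(\mathbb 1\pm t\sigma_2),$$ where $\sigma_1,\sigma_2$ are the first two Pauli matrices. Proposition. For $0\le t\le1$, the observables $\mathsf A^{t\mathbf x}$ and $\mathsf A^{t\mathbf y}$ are incompatible if and only if $1/\sqrt2<t\le 1$. Moreover, there exists $t_0$ with $1/\sqrt2<t_0<1$ such that $\chi_{incomp}(\mathsf A^{t\mathbf x},\mathsf A^{t\mathbf y})=3$ for all $t$ with $1/\sqrt2<t\le t_0$, and $\chi_{incomp}(\mathsf A^{t\mathbf x},\mathsf A^{t\mathbf y})=2$ for all $t$ with $t_0<t\le 1$. -/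

import Mathlib

open scoped ComplexOrder

noncomputable section

/-- The set of density operators (states) on the Hilbert space `ℂ^d`. -/
def densityOperators (d : Type) [Fintype d] : Set (Matrix d d ℂ) :=
  {ρ | ρ.PosSemidef ∧ ρ.trace = 1}

/-- An observable (POVM) on `ℂ^d` with finite outcome set `X`: positive semidefinite operators
`A(x)`, `x ∈ X`, that sum up to the identity. -/
structure Observable (d : Type) [Fintype d] [DecidableEq d] (X : Type) [Fintype X] where
  /-- the operator `A(x)` attached to the outcome `x` -/
  effect : X → Matrix d d ℂ
  posSemidef : ∀ x, (effect x).PosSemidef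
  sum_eq_one : ∑ x, effect x = 1

section Compatibility

variable {d : Type} [Fintype d] [DecidableEq d]
variable {ι : Type} [Fintype ι] [DecidableEq ι]
variable {X : ι → Type} [∀ j, Fintype (X j)] [∀ j, DecidableEq (X j)]

/-- A finite family of observables is compatible if there is a joint observable on the product
of the outcome sets whose `j`-th marginal is the `j`-th observable. -/
def Compatible (A : ∀ j, Observable d (X j)) : Prop :=
  ∃ G : Observable d (∀ j, X j), ∀ (j : ι) (x : X j),
    (A j).effect x = ∑ y ∈ Finset.univ.filter (fun y : ∀ j, X j => y j = x), G.effect y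

/-- A family of observables is `S₀`-compatible if there are compatible observables with the same
outcome sets that give the same outcome distributions `x ↦ tr(ρ A(x))` in all states
`ρ ∈ S₀`. -/
def CompatibleOn (S₀ : Set (Matrix d d ℂ)) (A : ∀ j, Observable d (X j)) : Prop :=
  ∃ A' : ∀ j, Observable d (X j), Compatible A' ∧
    ∀ (j : ι), ∀ ρ ∈ S₀, ∀ x : X j,
      (ρ * (A' j).effect x).trace = (ρ * (A j).effect x).trace

/-- The dimension of the affine hull of `S`, as a real affine subspace (with value `0` for the
empty set, on which all observables are compatible). -/
def affDim (S : Set (Matrix d d ℂ)) : ℕ :=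
  Module.finrank ℝ (affineSpan ℝ S).direction

/-- The incompatibility dimension: the least value of `dim aff S₀ + 1` among the sets of states
`S₀` on which the observables are incompatible. For incompatible observables there is such an
`S₀`, so this is a minimum; for compatible ones the notion is not used (the value is `0`). -/
def incompatibilityDim (A : ∀ j, Observable d (X j)) : ℕ :=
  sInf {m | ∃ S₀ ⊆ densityOperators d, ¬ CompatibleOn S₀ A ∧ m = affDim S₀ + 1}

end Compatibility

section Qubit

/-- The Pauli matrices `σ₁, σ₂, σ₃`, indexed by `0, 1, 2`. -/
def pauli : Fin 3 → Matrix (Fin 2) (Fin 2) ℂ :=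
  ![!![0, 1; 1, 0], !![0, -Complex.I; Complex.I, 0], !![1, 0; 0, -1]]

/-- `a · σ = a₁ σ₁ + a₂ σ₂ + a₃ σ₃`. -/
def dotPauli (a : EuclideanSpace ℝ (Fin 3)) : Matrix (Fin 2) (Fin 2) ℂ :=
  ∑ i, (a i : ℂ) • pauli i

/-- The operators `(1/2) (1 ± a · σ)`; the outcome set `{+, -}` is the unit group
`ℤˣ = {1, -1}`. -/
def unbiasedEffect (a : EuclideanSpace ℝ (Fin 3)) (s : ℤˣ) : Matrix (Fin 2) (Fin 2) ℂ :=
  (1 / 2 : ℂ) • (1 + ((s : ℤ) : ℂ) • dotPauli a)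

lemma dotPauli_isHermitian (a : EuclideanSpace ℝ (Fin 3)) : (dotPauli a).IsHermitian := by
  ext i j
  fin_cases i <;> fin_cases j <;>
    simp [dotPauli, pauli, Fin.sum_univ_three, Matrix.conjTranspose_apply]

lemma dotPauli_mul_self (a : EuclideanSpace ℝ (Fin 3)) :
    dotPauli a * dotPauli a = ((‖a‖ ^ 2 : ℝ) : ℂ) • (1 : Matrix (Fin 2) (Fin 2) ℂ) := by
  have h : ‖a‖ ^ 2 = a 0 ^ 2 + a 1 ^ 2 + a 2 ^ 2 := by
    rw [EuclideanSpace.norm_sq_eq, Fin.sum_univ_three]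
    simp
  rw [h]
  ext i j
  fin_cases i <;> fin_cases j <;>
    simp [dotPauli, pauli, Fin.sum_univ_three, Matrix.mul_apply] <;> ring_nf <;>
    simp [Complex.I_sq]

lemma unbiasedEffect_posSemidef (a : EuclideanSpace ℝ (Fin 3)) (ha : ‖a‖ ≤ 1) (s : ℤˣ) :
    (unbiasedEffect a s).PosSemidef := by
  set M : Matrix (Fin 2) (Fin 2) ℂ := 1 + ((s : ℤ) : ℂ) • dotPauli a with hM
  have hs : ((s : ℤ) : ℂ) * ((s : ℤ) : ℂ) = 1 := by
    rcases Int.units_eq_one_or s with h | h <;> simp [h]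
  have hH : M.conjTranspose = M := by
    rw [hM, Matrix.conjTranspose_add, Matrix.conjTranspose_smul, (dotPauli_isHermitian a).eq]
    simp
  have hsq : M * M = (2 : ℂ) • M - ((1 - ‖a‖ ^ 2 : ℝ) : ℂ) • (1 : Matrix (Fin 2) (Fin 2) ℂ) := by
    have h1 : M * M = 1 + (2 : ℂ) • (((s : ℤ) : ℂ) • dotPauli a)
        + (((s : ℤ) : ℂ) * ((s : ℤ) : ℂ)) • (dotPauli a * dotPauli a) := by
      rw [hM, mul_add, mul_one, add_mul, one_mul, smul_mul_smul_comm, two_smul]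
      abel
    rw [h1, hs, one_smul, dotPauli_mul_self, hM]
    push_cast
    module
  have hrep : unbiasedEffect a s = (1 / 4 : ℝ) • (M.conjTranspose * M)
      + ((1 - ‖a‖ ^ 2) / 4 : ℝ) • (1 : Matrix (Fin 2) (Fin 2) ℂ) := by
    rw [hH, hsq, unbiasedEffect, ← hM]
    ext i j
    simp only [Matrix.add_apply, Matrix.smul_apply, Matrix.sub_apply, smul_eq_mul,
      Complex.real_smul]
    push_cast
    ring
  rw [hrep]
  have hpos : 0 ≤ (1 - ‖a‖ ^ 2) / 4 := by nlinarith [norm_nonneg a]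
  exact ((Matrix.posSemidef_conjTranspose_mul_self M).smul (by norm_num)).add
    (Matrix.PosSemidef.one.smul hpos)

lemma sum_unbiasedEffect (a : EuclideanSpace ℝ (Fin 3)) : ∑ s, unbiasedEffect a s = 1 := by
  have hu : (Finset.univ : Finset ℤˣ) = {1, -1} := rfl
  rw [hu, Finset.sum_pair (by decide)]
  simp only [unbiasedEffect, Units.val_one, Units.val_neg]
  push_cast
  module

/-- The unbiased qubit observable `A^a(±) = (1/2) (1 ± a · σ)`, for `a ∈ ℝ³` with `|a| ≤ 1`. -/
def unbiasedQubit (a : EuclideanSpace ℝ (Fin 3)) (ha : ‖a‖ ≤ 1) :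
    Observable (Fin 2) ℤˣ where
  effect := unbiasedEffect a
  posSemidef := unbiasedEffect_posSemidef a ha
  sum_eq_one := sum_unbiasedEffect a

lemma norm_smul_single_le (t : Set.Icc (0 : ℝ) 1) (i : Fin 3) :
    ‖(t : ℝ) • EuclideanSpace.single i (1 : ℝ)‖ ≤ 1 := by
  rw [norm_smul, PiLp.norm_single, norm_one, mul_one, Real.norm_of_nonneg t.2.1]
  exact t.2.2

/-- The pair `(A^{t x}, A^{t y})` of noisy mutually unbiased qubit observables, `0 ≤ t ≤ 1`, with
`x = (1, 0, 0)` and `y = (0, 1, 0)`. -/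
def noisyPair (t : Set.Icc (0 : ℝ) 1) : Fin 2 → Observable (Fin 2) ℤˣ :=
  ![unbiasedQubit ((t : ℝ) • EuclideanSpace.single 0 1) (norm_smul_single_le t 0),
    unbiasedQubit ((t : ℝ) • EuclideanSpace.single 1 1) (norm_smul_single_le t 1)]

end Qubit

end

noncomputable section

/-! Everything reduces to the Bloch components of effects along `σ₁` and `σ₂`. In a four-outcome
joint observable each effect has planar Bloch vector no longer than its trace, so the signed
components of the marginals sum to at most `2√2` (`sum_bloch_marginal_le`). States that determine
the plane make this sum `4t`, which forces `t ≤ 1/√2`.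

For the threshold, let `K` be the set of `t` for which the pair is compatible on every set of states
of affine dimension at most one. It is closed, because joint observables form a compact set
(`isClosed_setOf_compatibleOn`), and downward closed, because noise can be mixed in
(`CompatibleOn.mono_noise`). It contains a point above `1/√2`: on a line of states one direction of
the plane is unconstrained, and this freedom is spent on an explicit perturbation
(`compatibleOn_of_affDim_le_one`). It misses `1` (`not_compatibleOn_pair`). Hence `t₀ = max K`
works, since three states always detect incompatibility and one state never does. -/

/-! ### Marginals and compatibility -/

/-- The `j`-th marginal of an observable on a product of outcome sets. -/
def Observable.marginal {d : Type} [Fintype d] [DecidableEq d] {ι : Type} [Fintype ι]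
    [DecidableEq ι] {X : ι → Type} [∀ j, Fintype (X j)] [∀ j, DecidableEq (X j)]
    (G : Observable d (∀ j, X j)) (j : ι) : Observable d (X j) where
  effect x := ∑ y ∈ Finset.univ.filter (fun y : ∀ j, X j => y j = x), G.effect y
  posSemidef x := Matrix.posSemidef_sum _ fun y _ => G.posSemidef y
  sum_eq_one := by rw [Finset.sum_fiberwise, G.sum_eq_one]

lemma compatible_marginal {d : Type} [Fintype d] [DecidableEq d] {ι : Type} [Fintype ι]
    [DecidableEq ι] {X : ι → Type} [∀ j, Fintype (X j)] [∀ j, DecidableEq (X j)]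
    (G : Observable d (∀ j, X j)) : Compatible G.marginal :=
  ⟨G, fun _ _ => rfl⟩

lemma compatibleOn_iff_exists_marginal {d : Type} [Fintype d] [DecidableEq d] {ι : Type}
    [Fintype ι] [DecidableEq ι] {X : ι → Type} [∀ j, Fintype (X j)] [∀ j, DecidableEq (X j)]
    {S : Set (Matrix d d ℂ)} {A : ∀ j, Observable d (X j)} :
    CompatibleOn S A ↔ ∃ G : Observable d (∀ j, X j), ∀ j, ∀ ρ ∈ S, ∀ x,
      (ρ * (G.marginal j).effect x).trace = (ρ * (A j).effect x).trace := by
  constructor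
  · rintro ⟨A', ⟨G, hG⟩, h⟩
    refine ⟨G, fun j ρ hρ x => ?_⟩
    rw [← h j ρ hρ x, hG j x]
    rfl
  · rintro ⟨G, h⟩
    exact ⟨G.marginal, compatible_marginal G, h⟩

lemma Compatible.compatibleOn {d : Type} [Fintype d] [DecidableEq d] {ι : Type}
    [Fintype ι] [DecidableEq ι] {X : ι → Type} [∀ j, Fintype (X j)] [∀ j, DecidableEq (X j)]
    {A : ∀ j, Observable d (X j)} (h : Compatible A) (S : Set (Matrix d d ℂ)) :
    CompatibleOn S A :=
  ⟨A, h, fun _ _ _ _ => rfl⟩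

/-! ### Bloch components of effects -/

/-- The real linear functional `M ↦ Re tr(M σ_{i+1})`. -/
def bloch (i : Fin 3) : Matrix (Fin 2) (Fin 2) ℂ →ₗ[ℝ] ℝ where
  toFun M := (M * pauli i).trace.re
  map_add' M N := by simp [add_mul]
  map_smul' c M := by simp

lemma bloch_zero_apply (M : Matrix (Fin 2) (Fin 2) ℂ) :
    bloch 0 M = (M 0 1).re + (M 1 0).re := by
  simp [bloch, pauli, Matrix.trace_fin_two, Matrix.mul_apply]

lemma bloch_one_apply (M : Matrix (Fin 2) (Fin 2) ℂ) :
    bloch 1 M = (M 1 0).im - (M 0 1).im := by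
  simp [bloch, pauli, Matrix.trace_fin_two, Matrix.mul_apply]
  ring

lemma trace_mul_pauli {M : Matrix (Fin 2) (Fin 2) ℂ} (h : M.IsHermitian) (i : Fin 3) :
    (M * pauli i).trace = (bloch i M : ℂ) := by
  have h00 := congrArg Complex.im (h.apply 0 0)
  have h11 := congrArg Complex.im (h.apply 1 1)
  have h01r := congrArg Complex.re (h.apply 0 1)
  have h01i := congrArg Complex.im (h.apply 0 1)
  simp at h00 h11 h01r h01i
  apply Complex.ext
  · rfl
  · fin_cases i <;> simp [pauli, Matrix.trace_fin_two, Matrix.mul_apply] <;> linarith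

lemma trace_re_nonneg {M : Matrix (Fin 2) (Fin 2) ℂ} (h : M.PosSemidef) : 0 ≤ M.trace.re :=
  (Complex.le_def.1 h.trace_nonneg).1

/-- This is `4 det M ≥ 0` in Bloch form, with the `σ₃` component dropped. -/
lemma bloch_sq_add_sq_le {M : Matrix (Fin 2) (Fin 2) ℂ} (h : M.PosSemidef) :
    bloch 0 M ^ 2 + bloch 1 M ^ 2 ≤ M.trace.re ^ 2 := by
  have hd := (Complex.le_def.1 h.det_nonneg).1
  have h00 := congrArg Complex.im (h.isHermitian.apply 0 0)
  have h11 := congrArg Complex.im (h.isHermitian.apply 1 1)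
  have h01r := congrArg Complex.re (h.isHermitian.apply 0 1)
  have h01i := congrArg Complex.im (h.isHermitian.apply 0 1)
  simp at h00 h11 h01r h01i
  rw [Matrix.det_fin_two] at hd
  simp at hd
  rw [bloch_zero_apply, bloch_one_apply, Matrix.trace_fin_two, Complex.add_re, h01r]
  have h01i' : (M 1 0).im = - (M 0 1).im := by linarith
  rw [h01i', h01r] at hd
  rw [h01i']
  have e00 : (M 0 0).im = 0 := by linarith
  rw [e00] at hd
  nlinarith [sq_nonneg ((M 0 0).re - (M 1 1).re)]

/-- The joint values of two marginals of a four-outcome observable in the directions `σ₁`, `σ₂`. -/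
lemma sum_bloch_marginal_le (G : Observable (Fin 2) (Fin 2 → ℤˣ)) :
    bloch 0 ((G.marginal 0).effect 1) - bloch 0 ((G.marginal 0).effect (-1))
      + bloch 1 ((G.marginal 1).effect 1) - bloch 1 ((G.marginal 1).effect (-1)) ≤ 2 * √2 := by
  -- Cauchy–Schwarz for each effect; summing over outcomes uses total trace `2`.
  have key (y : Fin 2 → ℤˣ) : ((y 0 : ℤ) : ℝ) * bloch 0 (G.effect y)
      + ((y 1 : ℤ) : ℝ) * bloch 1 (G.effect y) ≤ √2 * (G.effect y).trace.re := by
    have h1 := bloch_sq_add_sq_le (G.posSemidef y)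
    have h2 := trace_re_nonneg (G.posSemidef y)
    refine abs_le_of_sq_le_sq' ?_ (by positivity) |>.2
    rw [mul_pow, Real.sq_sqrt (by norm_num)]
    rcases Int.units_eq_one_or (y 0) with h | h <;>
      rcases Int.units_eq_one_or (y 1) with h' | h' <;>
      simp [h, h'] <;>
      nlinarith [sq_nonneg (bloch 0 (G.effect y) - bloch 1 (G.effect y)),
        sq_nonneg (bloch 0 (G.effect y) + bloch 1 (G.effect y))]
  have hsum := Finset.sum_le_sum fun y (_ : y ∈ Finset.univ) => key y
  have htr : ∑ y, √2 * (G.effect y).trace.re = 2 * √2 := by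
    rw [← Finset.mul_sum, ← Complex.re_sum, ← Matrix.trace_sum, G.sum_eq_one]
    simp [mul_comm]
  have hu : (Finset.univ : Finset ℤˣ) = {1, -1} := rfl
  have hm (j : Fin 2) (i : Fin 3) :
      ∑ y, ((y j : ℤ) : ℝ) * bloch i (G.effect y)
        = bloch i ((G.marginal j).effect 1) - bloch i ((G.marginal j).effect (-1)) := by
    rw [← Finset.sum_fiberwise Finset.univ (fun y : Fin 2 → ℤˣ => y j), hu,
      Finset.sum_pair (by decide)]
    simp only [Observable.marginal, map_sum]
    rw [sub_eq_add_neg, ← Finset.sum_neg_distrib]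
    congr 1 <;> refine Finset.sum_congr rfl fun y hy => ?_ <;>
      simp [(Finset.mem_filter.1 hy).2]
  rw [htr, Finset.sum_add_distrib, hm, hm] at hsum
  linarith

/-! ### Explicit joint observables -/

lemma posSemidef_smul_one_add_pauli {g x y : ℝ} (hg : 0 ≤ g) (h : x ^ 2 + y ^ 2 ≤ g ^ 2) :
    ((g : ℂ) • (1 : Matrix (Fin 2) (Fin 2) ℂ) + (x : ℂ) • pauli 0
      + (y : ℂ) • pauli 1).PosSemidef := by
  rcases hg.eq_or_lt with rfl | hg
  · have hx : x = 0 := by nlinarith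
    have hy : y = 0 := by nlinarith
    subst hx hy
    simpa using Matrix.PosSemidef.zero
  · have hn : ‖(!₂[x / g, y / g, 0] : EuclideanSpace ℝ (Fin 3))‖ ≤ 1 := by
      rw [EuclideanSpace.norm_eq, Real.sqrt_le_one, Fin.sum_univ_three]
      simp only [Real.norm_eq_abs, sq_abs]
      simp
      rw [div_pow, div_pow, ← add_div]
      exact (div_le_one (by positivity)).2 h
    have hM := (unbiasedEffect_posSemidef _ hn 1).smul (show (0 : ℝ) ≤ 2 * g by positivity)
    convert hM using 1
    have hg' : (g : ℂ) ≠ 0 := by exact_mod_cast hg.ne'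
    rw [unbiasedEffect, dotPauli, Fin.sum_univ_three]
    ext i j
    simp [Complex.real_smul]
    field_simp
    ring

/-- Four-outcome qubit observables in the `σ₁σ₂`-plane, through their Bloch coefficients. -/
lemma exists_joint_observable (a b c e₁ e₂ f₁ f₂ h₁ h₂ : ℝ)
    (hpos : ∀ i j : ℝ, i ^ 2 = 1 → j ^ 2 = 1 → 0 ≤ 1 + i * a + j * b + i * j * c)
    (hsq : ∀ i j : ℝ, i ^ 2 = 1 → j ^ 2 = 1 →
      (i * e₁ + j * f₁ + i * j * h₁) ^ 2 + (i * e₂ + j * f₂ + i * j * h₂) ^ 2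
        ≤ (1 + i * a + j * b + i * j * c) ^ 2) :
    ∃ G : Observable (Fin 2) (Fin 2 → ℤˣ),
      (∀ s, (G.marginal 0).effect s = (1 / 2 : ℂ) • ((1 + ((s : ℤ) : ℂ) * a) • 1
        + (((s : ℤ) : ℂ) * e₁) • pauli 0 + (((s : ℤ) : ℂ) * e₂) • pauli 1)) ∧
      (∀ s, (G.marginal 1).effect s = (1 / 2 : ℂ) • ((1 + ((s : ℤ) : ℂ) * b) • 1
        + (((s : ℤ) : ℂ) * f₁) • pauli 0 + (((s : ℤ) : ℂ) * f₂) • pauli 1)) := by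
  have hunit (s : ℤˣ) : ((s : ℤ) : ℝ) ^ 2 = 1 := by
    rcases Int.units_eq_one_or s with h | h <;> simp [h]
  have hu : (Finset.univ : Finset ℤˣ) = {1, -1} := rfl
  have hpi (F : (Fin 2 → ℤˣ) → Matrix (Fin 2) (Fin 2) ℂ) :
      ∑ y, F y = ∑ s, ∑ s', F ![s, s'] := by
    rw [← (finTwoArrowEquiv ℤˣ).symm.sum_comp, Fintype.sum_prod_type]
    rfl
  let E (y : Fin 2 → ℤˣ) : Matrix (Fin 2) (Fin 2) ℂ :=
    (1 / 4 : ℝ) • ((((1 + (y 0 : ℤ) * a + (y 1 : ℤ) * b + (y 0 : ℤ) * (y 1 : ℤ) * c : ℝ)) : ℂ) • 1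
      + (((y 0 : ℤ) * e₁ + (y 1 : ℤ) * f₁ + (y 0 : ℤ) * (y 1 : ℤ) * h₁ : ℝ) : ℂ) • pauli 0
      + (((y 0 : ℤ) * e₂ + (y 1 : ℤ) * f₂ + (y 0 : ℤ) * (y 1 : ℤ) * h₂ : ℝ) : ℂ) • pauli 1)
  have hE (y) : E y = (1 / 4 : ℂ) •
      ((1 + ((y 0 : ℤ) : ℂ) * a + ((y 1 : ℤ) : ℂ) * b + ((y 0 : ℤ) : ℂ) * ((y 1 : ℤ) : ℂ) * c) • 1
      + (((y 0 : ℤ) : ℂ) * e₁ + ((y 1 : ℤ) : ℂ) * f₁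
        + ((y 0 : ℤ) : ℂ) * ((y 1 : ℤ) : ℂ) * h₁) • pauli 0
      + (((y 0 : ℤ) : ℂ) * e₂ + ((y 1 : ℤ) : ℂ) * f₂
        + ((y 0 : ℤ) : ℂ) * ((y 1 : ℤ) : ℂ) * h₂) • pauli 1) := by
    ext i j
    simp [E, Complex.real_smul]
    ring
  refine ⟨⟨E, fun y => ?_, ?_⟩, fun s => ?_, fun s => ?_⟩
  · exact (posSemidef_smul_one_add_pauli (hpos _ _ (hunit _) (hunit _))
      (hsq _ _ (hunit _) (hunit _))).smul (by norm_num)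
  · rw [hpi, hu, Finset.sum_pair (by decide), Finset.sum_pair (by decide),
      Finset.sum_pair (by decide)]
    simp only [hE]
    simp
    module
  all_goals
    simp only [Observable.marginal]
    rw [Finset.sum_filter, hpi, hu, Finset.sum_pair (by decide), Finset.sum_pair (by decide),
      Finset.sum_pair (by decide)]
    simp only [hE]
    rcases Int.units_eq_one_or s with rfl | rfl <;> simp <;> module

lemma noisyPair_effect_zero (t : Set.Icc (0 : ℝ) 1) (s : ℤˣ) :
    (noisyPair t 0).effect s = (1 / 2 : ℂ) • (1 + (((s : ℤ) : ℂ) * (t : ℝ)) • pauli 0) := by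
  change unbiasedEffect ((t : ℝ) • EuclideanSpace.single 0 1) s = _
  rw [unbiasedEffect, dotPauli, Fin.sum_univ_three]
  ext i j
  simp
  ring

lemma noisyPair_effect_one (t : Set.Icc (0 : ℝ) 1) (s : ℤˣ) :
    (noisyPair t 1).effect s = (1 / 2 : ℂ) • (1 + (((s : ℤ) : ℂ) * (t : ℝ)) • pauli 1) := by
  change unbiasedEffect ((t : ℝ) • EuclideanSpace.single 1 1) s = _
  rw [unbiasedEffect, dotPauli, Fin.sum_univ_three]
  ext i j
  simp
  ring

/-- Matching the Bloch coefficients of a joint observable on the states of `S`. -/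
lemma compatibleOn_noisyPair_of_bloch {S : Set (Matrix (Fin 2) (Fin 2) ℂ)}
    (hS : S ⊆ densityOperators (Fin 2)) (t : Set.Icc (0 : ℝ) 1)
    (a b c e₁ e₂ f₁ f₂ h₁ h₂ : ℝ)
    (hpos : ∀ i j : ℝ, i ^ 2 = 1 → j ^ 2 = 1 → 0 ≤ 1 + i * a + j * b + i * j * c)
    (hsq : ∀ i j : ℝ, i ^ 2 = 1 → j ^ 2 = 1 →
      (i * e₁ + j * f₁ + i * j * h₁) ^ 2 + (i * e₂ + j * f₂ + i * j * h₂) ^ 2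
        ≤ (1 + i * a + j * b + i * j * c) ^ 2)
    (h0 : ∀ ρ ∈ S, a + e₁ * bloch 0 ρ + e₂ * bloch 1 ρ = t * bloch 0 ρ)
    (h1 : ∀ ρ ∈ S, b + f₁ * bloch 0 ρ + f₂ * bloch 1 ρ = t * bloch 1 ρ) :
    CompatibleOn S (noisyPair t) := by
  obtain ⟨G, hG0, hG1⟩ := exists_joint_observable a b c e₁ e₂ f₁ f₂ h₁ h₂ hpos hsq
  refine compatibleOn_iff_exists_marginal.2 ⟨G, fun j ρ hρ s => ?_⟩
  have hH := (hS hρ).1.isHermitian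
  have key0 : (a : ℂ) + e₁ * bloch 0 ρ + e₂ * bloch 1 ρ = (t : ℝ) * bloch 0 ρ := by
    exact_mod_cast h0 ρ hρ
  have key1 : (b : ℂ) + f₁ * bloch 0 ρ + f₂ * bloch 1 ρ = (t : ℝ) * bloch 1 ρ := by
    exact_mod_cast h1 ρ hρ
  fin_cases j
  · simp only [Fin.zero_eta, hG0, noisyPair_effect_zero, mul_smul_comm, mul_add, mul_one,
      Matrix.trace_smul, Matrix.trace_add, trace_mul_pauli hH, (hS hρ).2, smul_eq_mul]
    linear_combination (1 / 2 : ℂ) * ((s : ℤ) : ℂ) * key0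
  · simp only [Fin.mk_one, hG1, noisyPair_effect_one, mul_smul_comm, mul_add, mul_one,
      Matrix.trace_smul, Matrix.trace_add, trace_mul_pauli hH, (hS hρ).2, smul_eq_mul]
    linear_combination (1 / 2 : ℂ) * ((s : ℤ) : ℂ) * key1

lemma compatible_noisyPair_of_le (t : Set.Icc (0 : ℝ) 1) (ht : (t : ℝ) ≤ 1 / √2) :
    Compatible (noisyPair t) := by
  have ht2 : (t : ℝ) ^ 2 ≤ 1 / 2 := by
    have := pow_le_pow_left₀ t.2.1 ht 2
    rwa [div_pow, Real.sq_sqrt (by norm_num), one_pow] at this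
  -- The effects are `(1 + t(iσ₁ + jσ₂))/4`, with Bloch vector of length `t√2 ≤ 1`.
  obtain ⟨G, hG0, hG1⟩ := exists_joint_observable 0 0 0 t 0 0 t 0 0
    (fun i j _ _ => by simp) (fun i j hi hj => by
      simp [mul_pow, hi, hj]
      linarith)
  refine ⟨G, fun j s => ?_⟩
  fin_cases j
  · refine Eq.trans ?_ (hG0 s).symm
    rw [Fin.zero_eta, noisyPair_effect_zero]
    simp
  · refine Eq.trans ?_ (hG1 s).symm
    rw [Fin.mk_one, noisyPair_effect_one]
    simp

/-! ### States that detect incompatibility -/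

/-- The pure state `(1 + x σ₁ + y σ₂) / 2`, when `x² + y² = 1`. -/
def planeState (x y : ℝ) : Matrix (Fin 2) (Fin 2) ℂ :=
  (1 / 2 : ℝ) • (((1 : ℝ) : ℂ) • (1 : Matrix (Fin 2) (Fin 2) ℂ) + (x : ℂ) • pauli 0
      + (y : ℂ) • pauli 1)

lemma planeState_mem {x y : ℝ} (h : x ^ 2 + y ^ 2 ≤ 1) :
    planeState x y ∈ densityOperators (Fin 2) := by
  refine ⟨(posSemidef_smul_one_add_pauli zero_le_one (by simpa using h)).smul (by norm_num), ?_⟩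
  simp [planeState, pauli, Matrix.trace_fin_two]

lemma trace_planeState_mul_re (x y : ℝ) (M : Matrix (Fin 2) (Fin 2) ℂ) :
    (planeState x y * M).trace.re = (M.trace.re + x * bloch 0 M + y * bloch 1 M) / 2 := by
  have h0 : bloch 0 M = (pauli 0 * M).trace.re := by rw [Matrix.trace_mul_comm]; rfl
  have h1 : bloch 1 M = (pauli 1 * M).trace.re := by rw [Matrix.trace_mul_comm]; rfl
  simp [planeState, add_mul, Matrix.trace_add, h0, h1]
  ring

lemma noisyPair_values (t : Set.Icc (0 : ℝ) 1) (s : ℤˣ) :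
    (((noisyPair t 0).effect s).trace.re = 1 ∧ bloch 0 ((noisyPair t 0).effect s) = (s : ℤ) * t ∧
      bloch 1 ((noisyPair t 0).effect s) = 0) ∧
    (((noisyPair t 1).effect s).trace.re = 1 ∧ bloch 0 ((noisyPair t 1).effect s) = 0 ∧
      bloch 1 ((noisyPair t 1).effect s) = (s : ℤ) * t) := by
  rw [noisyPair_effect_zero, noisyPair_effect_one]
  rcases Int.units_eq_one_or s with rfl | rfl <;>
    simp [bloch_zero_apply, bloch_one_apply, pauli, Matrix.trace_fin_two] <;> ring_nf <;> simp

/-- Three pure states spanning the `σ₁σ₂`-plane detect the incompatibility. -/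
lemma not_compatibleOn_triple (t : Set.Icc (0 : ℝ) 1) (ht : 1 / √2 < (t : ℝ)) :
    ¬ CompatibleOn {planeState 1 0, planeState (-1) 0, planeState 0 1} (noisyPair t) := by
  rw [compatibleOn_iff_exists_marginal]
  rintro ⟨G, hG⟩
  have key (j : Fin 2) (s : ℤˣ) :
      bloch 0 ((G.marginal j).effect s) = bloch 0 ((noisyPair t j).effect s) ∧
      bloch 1 ((G.marginal j).effect s) = bloch 1 ((noisyPair t j).effect s) := by
    have h1 := congrArg Complex.re (hG j (planeState 1 0) (by simp) s)
    have h2 := congrArg Complex.re (hG j (planeState (-1) 0) (by simp) s)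
    have h3 := congrArg Complex.re (hG j (planeState 0 1) (by simp) s)
    rw [trace_planeState_mul_re, trace_planeState_mul_re] at h1 h2 h3
    constructor <;> linarith
  have hle := sum_bloch_marginal_le G
  rw [(key 0 1).1, (key 0 (-1)).1, (key 1 1).2, (key 1 (-1)).2, (noisyPair_values t 1).1.2.1,
    (noisyPair_values t (-1)).1.2.1, (noisyPair_values t 1).2.2.2,
    (noisyPair_values t (-1)).2.2.2] at hle
  push_cast at hle
  rw [div_lt_iff₀ (by positivity)] at ht
  nlinarith [Real.sq_sqrt (show (0 : ℝ) ≤ 2 by norm_num),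
    Real.sqrt_pos.2 (show (0 : ℝ) < 2 by norm_num)]

lemma affDim_triple_le : affDim ({planeState 1 0, planeState (-1) 0, planeState 0 1} :
    Set (Matrix (Fin 2) (Fin 2) ℂ)) ≤ 2 := by
  rw [affDim, direction_affineSpan]
  exact (coplanar_triple ℝ _ _ _).finrank_le_two

lemma affDim_pair_le : affDim ({planeState 1 0, planeState 0 1} :
    Set (Matrix (Fin 2) (Fin 2) ℂ)) ≤ 1 := by
  rw [affDim, direction_affineSpan]
  exact (collinear_pair ℝ _ _).finrank_le_one

/-- The eigenstates of `σ₁` and `σ₂` detect the incompatibility of the sharp pair. -/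
lemma not_compatibleOn_pair (t : Set.Icc (0 : ℝ) 1) (ht : (t : ℝ) = 1) :
    ¬ CompatibleOn {planeState 1 0, planeState 0 1} (noisyPair t) := by
  rw [compatibleOn_iff_exists_marginal]
  rintro ⟨G, hG⟩
  have h1 (j : Fin 2) (s : ℤˣ) := congrArg Complex.re (hG j (planeState 1 0) (by simp) s)
  have h2 (j : Fin 2) (s : ℤˣ) := congrArg Complex.re (hG j (planeState 0 1) (by simp) s)
  simp only [trace_planeState_mul_re] at h1 h2
  have hb (j : Fin 2) := bloch_sq_add_sq_le ((G.marginal j).posSemidef (-1))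
  have htr (j : Fin 2) : ((G.marginal j).effect 1).trace.re
      + ((G.marginal j).effect (-1)).trace.re = 2 := by
    have hu : (Finset.univ : Finset ℤˣ) = {1, -1} := rfl
    have := (G.marginal j).sum_eq_one
    rw [hu, Finset.sum_pair (by decide)] at this
    rw [← Complex.add_re, ← Matrix.trace_add, this]
    simp
  have hle := sum_bloch_marginal_le G
  have a1 := h1 0 1
  have a2 := h1 0 (-1)
  have a3 := h2 0 1
  have a4 := h2 0 (-1)
  have b1 := h1 1 1
  have b2 := h1 1 (-1)
  have b3 := h2 1 1
  have b4 := h2 1 (-1)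
  rw [(noisyPair_values t _).1.1, (noisyPair_values t _).1.2.1, (noisyPair_values t _).1.2.2,
    ht] at a1 a2 a3 a4
  rw [(noisyPair_values t _).2.1, (noisyPair_values t _).2.2.1, (noisyPair_values t _).2.2.2,
    ht] at b1 b2 b3 b4
  have hb0 := hb 0
  have hb1 := hb 1
  have htr0 := htr 0
  have htr1 := htr 1
  push_cast at a1 a2 a3 a4 b1 b2 b3 b4
  generalize bloch 0 ((G.marginal 0).effect 1) = x1 at *
  generalize bloch 0 ((G.marginal 0).effect (-1)) = x2 at *
  generalize bloch 1 ((G.marginal 0).effect (-1)) = x3 at *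
  generalize bloch 1 ((G.marginal 1).effect 1) = y1 at *
  generalize bloch 1 ((G.marginal 1).effect (-1)) = y2 at *
  generalize bloch 0 ((G.marginal 1).effect (-1)) = y3 at *
  generalize ((G.marginal 0).effect (-1)).trace.re = z at *
  generalize ((G.marginal 1).effect (-1)).trace.re = w at *
  -- In the `+` eigenstate the outcome `-` has probability zero, so its effect has extremal Bloch
  -- vector and no transverse component. The other state then fixes its trace at `1`, so all four
  -- marginal components are `±1` and their signed sum is `4 > 2√2`.
  have hx : x2 = -z := by linarith
  have hy : y2 = -w := by linarith
  have hx3 : x3 = 0 := by subst hx; nlinarith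
  have hy3 : y3 = 0 := by subst hy; nlinarith
  have h4 : (4 : ℝ) ≤ 2 * √2 := by linarith
  nlinarith [Real.sq_sqrt (show (0 : ℝ) ≤ 2 by norm_num), Real.sqrt_nonneg 2]

/-! ### Sets of states of dimension at most one -/

lemma densityOperators_bloch_sq_le {ρ : Matrix (Fin 2) (Fin 2) ℂ}
    (h : ρ ∈ densityOperators (Fin 2)) : bloch 0 ρ ^ 2 + bloch 1 ρ ^ 2 ≤ 1 := by
  have := bloch_sq_add_sq_le h.1
  rwa [h.2, Complex.one_re, one_pow] at this

/-- On a single state, the product of the two outcome distributions, times the identity, is a joint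
observable. -/
lemma compatibleOn_of_affDim_eq_zero {S : Set (Matrix (Fin 2) (Fin 2) ℂ)}
    (hS : S ⊆ densityOperators (Fin 2)) (hd : affDim S = 0) (t : Set.Icc (0 : ℝ) 1) :
    CompatibleOn S (noisyPair t) := by
  rcases S.eq_empty_or_nonempty with rfl | ⟨ρ, hρ⟩
  · exact compatibleOn_noisyPair_of_bloch hS t 0 0 0 0 0 0 0 0 0 (by simp) (by simp) (by simp)
      (by simp)
  have hall : ∀ ρ' ∈ S, ρ' = ρ := by
    intro ρ' hρ'
    rw [affDim, direction_affineSpan, Submodule.finrank_eq_zero] at hd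
    have := vsub_mem_vectorSpan ℝ hρ' hρ
    rw [hd, Submodule.mem_bot, vsub_eq_sub] at this
    exact sub_eq_zero.1 this
  have hb := densityOperators_bloch_sq_le (hS hρ)
  have hbd (u v : ℝ) (h : u ^ 2 + v ^ 2 ≤ 1) (i : ℝ) (hi : i ^ 2 = 1) :
      0 ≤ 1 + i * (t * u) := by
    have : (i * (t * u)) ^ 2 ≤ 1 ^ 2 := by
      rw [mul_pow, mul_pow, hi]
      have h1 : (t : ℝ) ^ 2 ≤ 1 := pow_le_one₀ t.2.1 t.2.2
      nlinarith [sq_nonneg u, sq_nonneg v, sq_nonneg (t : ℝ)]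
    linarith [(abs_le_of_sq_le_sq' this zero_le_one).1]
  have hp (i j : ℝ) (hi : i ^ 2 = 1) (hj : j ^ 2 = 1) :
      0 ≤ 1 + i * (t * bloch 0 ρ) + j * (t * bloch 1 ρ)
        + i * j * ((t * bloch 0 ρ) * (t * bloch 1 ρ)) := by
    have := mul_nonneg (hbd _ _ hb i hi) (hbd (bloch 1 ρ) (bloch 0 ρ) (by linarith) j hj)
    linarith
  refine compatibleOn_noisyPair_of_bloch hS t (t * bloch 0 ρ) (t * bloch 1 ρ)
    ((t * bloch 0 ρ) * (t * bloch 1 ρ)) 0 0 0 0 0 0 hp (fun i j hi hj => ?_)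
    (fun ρ' h => ?_) (fun ρ' h => ?_)
  · simpa using sq_nonneg _
  · simp [hall ρ' h]
  · simp [hall ρ' h]

/-- On a line of states some direction of the `σ₁σ₂`-plane has constant expectation. -/
lemma exists_constant_direction {S : Set (Matrix (Fin 2) (Fin 2) ℂ)}
    (hS : S ⊆ densityOperators (Fin 2)) (hd : affDim S ≤ 1) :
    ∃ m₁ m₂ d : ℝ, m₁ ^ 2 + m₂ ^ 2 = 1 ∧ d ^ 2 ≤ 1 ∧
      ∀ ρ ∈ S, m₁ * bloch 0 ρ + m₂ * bloch 1 ρ = d := by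
  rcases S.eq_empty_or_nonempty with rfl | ⟨ρ, hρ⟩
  · exact ⟨1, 0, 0, by norm_num, by norm_num, by simp⟩
  rw [affDim, direction_affineSpan, finrank_le_one_iff] at hd
  obtain ⟨⟨u, _⟩, hu⟩ := hd
  -- Take `m` orthogonal to the planar Bloch vector of the direction of the line.
  obtain ⟨m₁, m₂, hm, hmu⟩ : ∃ m₁ m₂ : ℝ, m₁ ^ 2 + m₂ ^ 2 = 1 ∧
      m₁ * bloch 0 u + m₂ * bloch 1 u = 0 := by
    by_cases h : bloch 0 u ^ 2 + bloch 1 u ^ 2 = 0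
    · have h0 : bloch 0 u = 0 := by nlinarith [sq_nonneg (bloch 0 u), sq_nonneg (bloch 1 u)]
      have h1 : bloch 1 u = 0 := by nlinarith [sq_nonneg (bloch 0 u), sq_nonneg (bloch 1 u)]
      exact ⟨1, 0, by norm_num, by simp [h0]⟩
    · refine ⟨-bloch 1 u / √(bloch 0 u ^ 2 + bloch 1 u ^ 2),
        bloch 0 u / √(bloch 0 u ^ 2 + bloch 1 u ^ 2), ?_, by ring⟩
      rw [div_pow, div_pow, Real.sq_sqrt (by positivity)]
      field_simp
      ring
  refine ⟨m₁, m₂, m₁ * bloch 0 ρ + m₂ * bloch 1 ρ, hm, ?_, fun ρ' hρ' => ?_⟩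
  · have := densityOperators_bloch_sq_le (hS hρ)
    nlinarith [sq_nonneg (m₁ * bloch 1 ρ - m₂ * bloch 0 ρ)]
  · obtain ⟨k, hk⟩ := hu ⟨_, vsub_mem_vectorSpan ℝ hρ' hρ⟩
    have hk' : k • u = ρ' - ρ := congrArg Subtype.val hk
    have h0 := congrArg (bloch 0) hk'
    have h1 := congrArg (bloch 1) hk'
    simp only [map_smul, map_sub, smul_eq_mul] at h0 h1
    linear_combination k * hmu - m₁ * h0 - m₂ * h1

/-- Positivity of one perturbed effect with planar Bloch vector `(x, y)` and trace coefficient `R`.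
Use `2(x² + y²) = (x + y)² + (x - y)²`: raising `t` adds `1/200` to `x + y` and the perturbation
removes `1/100`, leaving `rR - 1/200`, while `x - y` is of order `1/100` and enters only squared. -/
lemma bloch_norm_bound {r m₁ m₂ d : ℝ} (hr : r ^ 2 = 2) (hr0 : 0 < r)
    (hm : m₁ ^ 2 + m₂ ^ 2 = 1) (hd : d ^ 2 ≤ 1) :
    0 ≤ 1 + d * (m₁ + m₂) / 100 - r * m₁ * m₂ / 100 ∧
    (r / 2 + 1 / 400 - m₁ * (m₁ + m₂) / 100 + r * d * m₂ / 100) ^ 2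
      + (r / 2 + 1 / 400 - m₂ * (m₁ + m₂) / 100 + r * d * m₁ / 100) ^ 2
      ≤ (1 + d * (m₁ + m₂) / 100 - r * m₁ * m₂ / 100) ^ 2 := by
  have hr2 : r ≤ 3 / 2 := by nlinarith
  have hr1 : 1 ≤ r := by nlinarith
  have h1 : |d * (m₁ + m₂)| ≤ 2 := by
    apply abs_le_of_sq_le_sq _ (by norm_num)
    rw [mul_pow]
    nlinarith [sq_nonneg (m₁ - m₂), sq_nonneg (m₁ + m₂)]
  have h2 : |r * m₁ * m₂| ≤ 2 := by
    apply abs_le_of_sq_le_sq _ (by norm_num)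
    have : (r * m₁ * m₂) ^ 2 = 2 * (m₁ ^ 2 * m₂ ^ 2) := by rw [← hr]; ring
    rw [this]
    nlinarith [sq_nonneg (m₁ ^ 2 - m₂ ^ 2)]
  have hR : 9 / 10 ≤ 1 + d * (m₁ + m₂) / 100 - r * m₁ * m₂ / 100 := by
    linarith [(abs_le.1 h1).1, (abs_le.1 h2).2]
  refine ⟨by linarith, ?_⟩
  have hq : ((m₁ - m₂) * (m₁ + m₂ + r * d)) ^ 2 ≤ 16 := by
    have e1 : (m₁ - m₂) ^ 2 ≤ 2 := by nlinarith [sq_nonneg (m₁ + m₂)]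
    have e2 : (m₁ + m₂ + r * d) ^ 2 ≤ 8 := by
      have : (r * d) ^ 2 ≤ 2 := by rw [mul_pow, hr]; linarith
      nlinarith [sq_nonneg (m₁ - m₂), sq_nonneg (m₁ + m₂ - r * d)]
    rw [mul_pow]
    nlinarith [sq_nonneg (m₁ - m₂), sq_nonneg (m₁ + m₂ + r * d)]
  set R := 1 + d * (m₁ + m₂) / 100 - r * m₁ * m₂ / 100 with hRdef
  have hp : r / 2 + 1 / 400 - m₁ * (m₁ + m₂) / 100 + r * d * m₂ / 100
      + (r / 2 + 1 / 400 - m₂ * (m₁ + m₂) / 100 + r * d * m₁ / 100) = r * R - 1 / 200 := by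
    rw [hRdef]
    linear_combination (-(1 : ℝ) / 100) * hm + (m₁ * m₂ / 100) * hr
  have hm' : r / 2 + 1 / 400 - m₁ * (m₁ + m₂) / 100 + r * d * m₂ / 100
      - (r / 2 + 1 / 400 - m₂ * (m₁ + m₂) / 100 + r * d * m₁ / 100)
      = -((m₁ - m₂) * (m₁ + m₂ + r * d)) / 100 := by ring
  generalize r / 2 + 1 / 400 - m₁ * (m₁ + m₂) / 100 + r * d * m₂ / 100 = x at *
  generalize r / 2 + 1 / 400 - m₂ * (m₁ + m₂) / 100 + r * d * m₁ / 100 = y at *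
  generalize (m₁ - m₂) * (m₁ + m₂ + r * d) = q at *
  have hxy : 2 * (x ^ 2 + y ^ 2) = (r * R - 1 / 200) ^ 2 + (-q / 100) ^ 2 := by
    rw [← hp, ← hm']; ring
  have hRR : (r * R) ^ 2 = 2 * R ^ 2 := by rw [mul_pow, hr]
  have hrR : 9 / 10 ≤ r * R := by nlinarith
  nlinarith

/-- Slightly above `1 / √2` the pair is compatible on every line of states. -/
lemma compatibleOn_of_affDim_le_one {S : Set (Matrix (Fin 2) (Fin 2) ℂ)}
    (hS : S ⊆ densityOperators (Fin 2)) (hd : affDim S ≤ 1) (t : Set.Icc (0 : ℝ) 1)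
    (ht : (t : ℝ) = √2 / 2 + 1 / 400) : CompatibleOn S (noisyPair t) := by
  obtain ⟨m₁, m₂, d, hm, hd2, hS'⟩ := exists_constant_direction hS hd
  have hr : (√2) ^ 2 = 2 := Real.sq_sqrt (by norm_num)
  have hr0 : 0 < √2 := by positivity
  -- Outcome signs are absorbed into `m`, so one inequality covers all four effects.
  have hb (i j : ℝ) (hi : i ^ 2 = 1) (hj : j ^ 2 = 1) :=
    bloch_norm_bound (m₁ := i * m₁) (m₂ := j * m₂) hr hr0
      (by rw [mul_pow, mul_pow, hi, hj]; linarith) hd2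
  -- Since `m · σ - d` has zero expectation on `S`, subtracting multiples of it proportional to `m₁`
  -- and `m₂` from the two observables goes unnoticed. The correlation terms do not affect the
  -- marginals; they are chosen so that `x + y` equals `√2 R` up to a constant.
  refine compatibleOn_noisyPair_of_bloch hS t (m₁ * d / 100) (m₂ * d / 100)
    (-(√2 * m₁ * m₂ / 100)) (t - m₁ ^ 2 / 100) (-(m₁ * m₂ / 100)) (-(m₁ * m₂ / 100))
    (t - m₂ ^ 2 / 100) (√2 * d * m₂ / 100) (√2 * d * m₁ / 100) (fun i j hi hj => ?_)
    (fun i j hi hj => ?_) (fun ρ hρ => ?_) (fun ρ hρ => ?_)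
  · convert (hb i j hi hj).1 using 1
    ring
  · rw [ht]
    refine le_trans (le_of_eq ?_) ((hb i j hi hj).2.trans (le_of_eq (by ring)))
    rcases sq_eq_one_iff.1 hi with rfl | rfl <;>
      rcases sq_eq_one_iff.1 hj with rfl | rfl <;> ring
  · linear_combination (-(m₁ / 100)) * hS' ρ hρ
  · linear_combination (-(m₂ / 100)) * hS' ρ hρ

/-! ### Dependence on the noise parameter -/

lemma isClosed_posSemidef {n : Type} [Fintype n] :
    IsClosed {M : Matrix n n ℂ | M.PosSemidef} := by
  simp only [Matrix.posSemidef_iff_dotProduct_mulVec, Set.ofPred_and, Set.ofPred_forall]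
  refine IsClosed.inter ?_ (isClosed_iInter fun x => ?_)
  · exact isClosed_eq (by fun_prop) continuous_id
  · exact isClosed_le continuous_const
      (continuous_const.dotProduct (continuous_id.matrix_mulVec continuous_const))

lemma norm_apply_le_trace_re {M : Matrix (Fin 2) (Fin 2) ℂ} (h : M.PosSemidef) (i j : Fin 2) :
    ‖M i j‖ ≤ M.trace.re := by
  have hd := (Complex.le_def.1 h.det_nonneg).1
  have d0 := Complex.le_def.1 (h.diag_nonneg (i := 0))
  have d1 := Complex.le_def.1 (h.diag_nonneg (i := 1))
  have h10 : M 1 0 = star (M 0 1) := (h.isHermitian.apply 1 0).symm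
  have hn : ‖M 0 1‖ ^ 2 ≤ (M 0 0).re * (M 1 1).re := by
    rw [Complex.sq_norm, Complex.normSq_apply]
    rw [Matrix.det_fin_two, h10] at hd
    simp at hd d0
    rw [← d0.2] at hd
    linarith
  have e0 : ‖M 0 0‖ = (M 0 0).re := by
    rw [← Complex.re_eq_norm.2 h.diag_nonneg]
  have e1 : ‖M 1 1‖ = (M 1 1).re := by
    rw [← Complex.re_eq_norm.2 h.diag_nonneg]
  simp only [Complex.zero_re] at d0 d1
  have h01 : ‖M 0 1‖ ≤ (M 0 0).re + (M 1 1).re :=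
    (abs_le_of_sq_le_sq' (by nlinarith) (by linarith)).2
  rw [Matrix.trace_fin_two, Complex.add_re]
  fin_cases i <;> fin_cases j
  · simp only [Fin.zero_eta, e0]; linarith
  · exact h01
  · simpa only [Fin.mk_one, Fin.zero_eta, h10, norm_star] using h01
  · simp only [Fin.mk_one, e1]; linarith

lemma isCompact_setOf_observable (Y : Type) [Fintype Y] :
    IsCompact {f : Y → Matrix (Fin 2) (Fin 2) ℂ | (∀ y, (f y).PosSemidef) ∧ ∑ y, f y = 1} := by
  have hK : IsCompact (Set.univ.pi fun _ : Y => Set.univ.pi fun _ : Fin 2 =>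
      Set.univ.pi fun _ : Fin 2 => Metric.closedBall (0 : ℂ) 2) :=
    isCompact_univ_pi fun _ => isCompact_univ_pi fun _ => isCompact_univ_pi fun _ =>
      isCompact_closedBall _ _
  have hclosed : IsClosed {f : Y → Matrix (Fin 2) (Fin 2) ℂ |
      (∀ y, (f y).PosSemidef) ∧ ∑ y, f y = 1} := by
    simp only [Set.ofPred_and, Set.ofPred_forall]
    refine IsClosed.inter (isClosed_iInter fun y => ?_) ?_
    · exact isClosed_posSemidef.preimage
        (continuous_apply (A := fun _ : Y => Matrix (Fin 2) (Fin 2) ℂ) y)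
    · exact isClosed_eq (continuous_finsetSum _ fun y _ => continuous_apply y) continuous_const
  refine IsCompact.of_isClosed_subset (X := Y → Matrix (Fin 2) (Fin 2) ℂ) hK hclosed ?_
  rintro (f : Y → Matrix (Fin 2) (Fin 2) ℂ) ⟨hf, hsum⟩ y - i - j -
  rw [mem_closedBall_zero_iff]
  refine (norm_apply_le_trace_re (hf y) i j).trans ?_
  calc (f y).trace.re ≤ ∑ z, (f z).trace.re :=
        Finset.single_le_sum (fun z _ => trace_re_nonneg (hf z)) (Finset.mem_univ y)
    _ = 2 := by
        rw [← Complex.re_sum, ← Matrix.trace_sum, hsum]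
        simp

lemma continuous_noisyPair_effect (j : Fin 2) (s : ℤˣ) :
    Continuous fun t : Set.Icc (0 : ℝ) 1 => (noisyPair t j).effect s := by
  fin_cases j
  · simp only [Fin.zero_eta, noisyPair_effect_zero]
    fun_prop
  · simp only [Fin.mk_one, noisyPair_effect_one]
    fun_prop

/-- The set is the projection to `t` of a compact set of pairs (joint observable, `t`). -/
lemma isClosed_setOf_compatibleOn (S : Set (Matrix (Fin 2) (Fin 2) ℂ)) :
    IsClosed {t : Set.Icc (0 : ℝ) 1 | CompatibleOn S (noisyPair t)} := by
  let Z : Set (((Fin 2 → ℤˣ) → Matrix (Fin 2) (Fin 2) ℂ) × Set.Icc (0 : ℝ) 1) :=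
    {p | ((∀ y, (p.1 y).PosSemidef) ∧ ∑ y, p.1 y = 1) ∧ ∀ j, ∀ ρ ∈ S, ∀ x,
      (ρ * ∑ y ∈ Finset.univ.filter (fun y : Fin 2 → ℤˣ => y j = x), p.1 y).trace
        = (ρ * (noisyPair p.2 j).effect x).trace}
  have hZ : IsCompact Z := by
    refine ((isCompact_setOf_observable (Fin 2 → ℤˣ)).prod
      (isCompact_univ (X := Set.Icc (0 : ℝ) 1))).of_isClosed_subset ?_
      fun p hp => ⟨hp.1, Set.mem_univ _⟩
    simp only [Z]
    rw [Set.ofPred_and]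
    refine IsClosed.inter
      ((isCompact_setOf_observable (Fin 2 → ℤˣ)).isClosed.preimage continuous_fst) ?_
    simp only [Set.ofPred_forall]
    refine isClosed_iInter fun j => isClosed_iInter fun ρ => isClosed_iInter fun _ =>
      isClosed_iInter fun x => isClosed_eq ?_ ?_
    · exact (continuous_const.matrix_mul (continuous_finsetSum _ fun y _ =>
        (continuous_apply y).comp continuous_fst)).matrix_trace
    · exact (continuous_const.matrix_mul
        ((continuous_noisyPair_effect j x).comp continuous_snd)).matrix_trace
  convert (hZ.image continuous_snd).isClosed using 1
  ext t
  simp only [Set.mem_ofPred_eq, compatibleOn_iff_exists_marginal, Set.mem_image, Prod.exists,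
    exists_eq_right]
  constructor
  · rintro ⟨G, hG⟩
    exact ⟨G.effect, ⟨G.posSemidef, G.sum_eq_one⟩, hG⟩
  · rintro ⟨f, ⟨h1, h2⟩, h3⟩
    exact ⟨⟨f, h1, h2⟩, h3⟩

/-- Adding white noise preserves compatibility. -/
lemma CompatibleOn.mono_noise {S : Set (Matrix (Fin 2) (Fin 2) ℂ)} {s t : Set.Icc (0 : ℝ) 1}
    (hst : s ≤ t) (h : CompatibleOn S (noisyPair t)) : CompatibleOn S (noisyPair s) := by
  rw [compatibleOn_iff_exists_marginal] at h ⊢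
  obtain ⟨G, hG⟩ := h
  -- Mixing weight `s / t`; for `t = 0` also `s = 0`, and `1` serves.
  obtain ⟨c, hc0, hc1, hc⟩ : ∃ c : ℝ, 0 ≤ c ∧ c ≤ 1 ∧ (s : ℝ) = c * t := by
    rcases t.2.1.eq_or_lt with h0 | h0
    · exact ⟨1, zero_le_one, le_rfl, by
        have : (s : ℝ) ≤ t := hst
        linarith [s.2.1]⟩
    · exact ⟨s / t, div_nonneg s.2.1 h0.le, (div_le_one h0).2 hst, by field_simp⟩
  obtain ⟨N, hN0, hN1⟩ := exists_joint_observable 0 0 0 0 0 0 0 0 0 (by simp) (by simp)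
  have hN (j : Fin 2) (x : ℤˣ) : (N.marginal j).effect x = (1 / 2 : ℂ) • 1 := by
    fin_cases j
    · exact (hN0 x).trans (by simp)
    · exact (hN1 x).trans (by simp)
  have hs (j : Fin 2) (x : ℤˣ) : (noisyPair s j).effect x
      = c • (noisyPair t j).effect x + (1 - c) • (1 / 2 : ℂ) • 1 := by
    fin_cases j
    · simp only [Fin.zero_eta, noisyPair_effect_zero, hc]
      ext i k
      simp
      ring
    · simp only [Fin.mk_one, noisyPair_effect_one, hc]
      ext i k
      simp
      ring
  refine ⟨⟨fun y => c • G.effect y + (1 - c) • N.effect y, fun y => ?_, ?_⟩, fun j ρ hρ x => ?_⟩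
  · exact ((G.posSemidef y).smul hc0).add ((N.posSemidef y).smul (sub_nonneg.2 hc1))
  · rw [Finset.sum_add_distrib, ← Finset.smul_sum, ← Finset.smul_sum, G.sum_eq_one, N.sum_eq_one]
    module
  · have key : ∑ y ∈ Finset.univ.filter (fun y : Fin 2 → ℤˣ => y j = x),
        (c • G.effect y + (1 - c) • N.effect y)
        = c • (G.marginal j).effect x + (1 - c) • (1 / 2 : ℂ) • 1 := by
      rw [← hN j x, Finset.sum_add_distrib, ← Finset.smul_sum, ← Finset.smul_sum]
      rfl
    change (ρ * ∑ y ∈ Finset.univ.filter (fun y : Fin 2 → ℤˣ => y j = x),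
        (c • G.effect y + (1 - c) • N.effect y)).trace = _
    rw [key, hs, mul_add, mul_add, Matrix.trace_add, Matrix.trace_add,
      mul_smul_comm c, mul_smul_comm c, Matrix.trace_smul, Matrix.trace_smul c,
      hG j ρ hρ x]

/-! ### The threshold -/

/-- An upper bound on the dimension of the witness suffices, since `hlow` rules out anything
smaller. -/
lemma incompatibilityDim_eq {X : Fin 2 → Type} [∀ j, Fintype (X j)] [∀ j, DecidableEq (X j)]
    {A : ∀ j, Observable (Fin 2) (X j)} {n : ℕ}
    (hex : ∃ S ⊆ densityOperators (Fin 2), ¬ CompatibleOn S A ∧ affDim S ≤ n)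
    (hlow : ∀ S ⊆ densityOperators (Fin 2), affDim S < n → CompatibleOn S A) :
    incompatibilityDim A = n + 1 := by
  obtain ⟨S, hS, hSA, hdim⟩ := hex
  have hmem : affDim S + 1 ∈ {m | ∃ S₀ ⊆ densityOperators (Fin 2),
      ¬ CompatibleOn S₀ A ∧ m = affDim S₀ + 1} := ⟨S, hS, hSA, rfl⟩
  refine le_antisymm ((Nat.sInf_le hmem).trans (by omega)) (le_csInf ⟨_, hmem⟩ ?_)
  rintro _ ⟨T, hT, hTA, rfl⟩
  have : ¬ affDim T < n := fun h => hTA (hlow T hT h)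
  omega

theorem mainTheorem1 :
    (∀ t : Set.Icc (0 : ℝ) 1, ¬ Compatible (noisyPair t) ↔ 1 / √2 < (t : ℝ)) ∧
    ∃ t₀ : ℝ, 1 / √2 < t₀ ∧ t₀ < 1 ∧
      ∀ t : Set.Icc (0 : ℝ) 1,
        (1 / √2 < (t : ℝ) → (t : ℝ) ≤ t₀ → incompatibilityDim (noisyPair t) = 3) ∧
        (t₀ < (t : ℝ) → incompatibilityDim (noisyPair t) = 2) := by
  refine ⟨fun t => ⟨fun h => ?_, fun h hc => not_compatibleOn_triple t h (hc.compatibleOn _)⟩, ?_⟩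
  · by_contra hlt
    exact h (compatible_noisyPair_of_le t (not_lt.1 hlt))
  let K : Set (Set.Icc (0 : ℝ) 1) := {t | ∀ S ⊆ densityOperators (Fin 2), affDim S ≤ 1 →
    CompatibleOn S (noisyPair t)}
  have hK : IsClosed K := by
    simp only [K, Set.ofPred_forall]
    exact isClosed_iInter fun S => isClosed_iInter fun _ => isClosed_iInter fun _ =>
      isClosed_setOf_compatibleOn S
  have hsq : (√2) ^ 2 = 2 := Real.sq_sqrt (by norm_num)
  have hs0 : 0 < √2 := by positivity
  have hs1 : √2 / 2 + 1 / 400 ≤ 1 := by nlinarith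
  have hs2 : 1 / √2 < √2 / 2 + 1 / 400 := by
    rw [div_lt_iff₀ hs0]
    nlinarith
  let t₁ : Set.Icc (0 : ℝ) 1 := ⟨√2 / 2 + 1 / 400, by positivity, hs1⟩
  have ht₁ : t₁ ∈ K := fun S hS hd => compatibleOn_of_affDim_le_one hS hd t₁ rfl
  obtain ⟨t₀, ht₀, hmax⟩ := hK.isCompact.exists_isGreatest ⟨t₁, ht₁⟩
  have hstates : ({planeState 1 0, planeState (-1) 0, planeState 0 1} :
      Set (Matrix (Fin 2) (Fin 2) ℂ)) ⊆ densityOperators (Fin 2) := by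
    rintro _ (rfl | rfl | rfl) <;> exact planeState_mem (by norm_num)
  refine ⟨t₀, hs2.trans_le (hmax ht₁), lt_of_le_of_ne t₀.2.2 fun h1 => ?_, fun t => ⟨?_, ?_⟩⟩
  · refine not_compatibleOn_pair t₀ h1 (ht₀ _ ?_ affDim_pair_le)
    rintro _ (rfl | rfl)
    · exact hstates (by simp)
    · exact hstates (by simp)
  · intro ht hle
    exact incompatibilityDim_eq ⟨_, hstates, not_compatibleOn_triple t ht, affDim_triple_le⟩
      fun S hS hd => (ht₀ S hS (Nat.le_of_lt_succ hd)).mono_noise hle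
  · intro hlt
    -- Maximality of `t₀` yields an incompatible set of dimension at most one.
    have htK : t ∉ K := fun h => absurd (hmax h) (not_le.2 hlt)
    simp only [K, Set.mem_ofPred_eq, not_forall] at htK
    obtain ⟨S, hS, hd, hc⟩ := htK
    exact incompatibilityDim_eq ⟨S, hS, hc, hd⟩
      fun T hT hdT => compatibleOn_of_affDim_eq_zero hT (by omega) t

end
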